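/- Let $d=N=8$. A $\mathcal{GR}(8,8)$ permutation set is a set $\{|L_1|,\ldots,|L_8|\}\subset S_8$, where $L_1,\ldots,L_8$ are $8\times 8$ signed permutation matrices satisfying $$L_IL_J^T+L_JL_I^T=2\delta_{IJ}\mathbb{I},\qquad L_I^TL_J+L_J^TL_I=2\delta_{IJ}\mathbb{I}\qquad(1\le I,J\le 8),$$ $|L|$ is the entrywise absolute value of $L$, and permutation matrices are identified with permutations. The dual of a set $C\subset S_8$ is $C^{-1}=\{c^{-1}: c\in C\}$, and $C$ is self-dual if $C^{-1}=C$. Let $A=\{a_1,\ldots,a_8\}\subset S_8$ be the subgroup with elements $a_1=(\,)$, $a_2=(1\,2)(3\,4)(5\,6)(7\,8)$, $a_3=(1\,3)(2\,4)(5\,7)(6\,8)$, $a_4=(1\,5)(2\,6)(3\,7)(4\,8)$, $a_5=(1\,8)(2\,7)(3\,6)(4\,5)$, $a_6=(1\,7)(2\,8)(3\,5)(4\,6)$, $a_7=(1\,6)(2\,5)(3\,8)(4\,7)$, $a_8=(1\,4)(2\,3)(5\,8)(6\,7)$, and for a subgroup $B$ of $S_8$ let $N(B)$ be its normalizer in $S_8$.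 Then: 1. The $\mathcal{GR}(8,8)$ permutation sets are exactly the left cosets $\pi B$ with $\pi\in S_8$ and $B$ a conjugate of $A$ in $S_8$, and $A$ has exactly $30$ conjugates. 2. For every conjugate $B$ of $A$ and every $\pi\in S_8$, the set $\pi B$ is self-dual if and only if $\pi\in N(B)$ and $\pi B$ has order at most $2$ in $N(B)/B$. Moreover $N(B)/B\cong \mathrm{SL}_3(\mathbb{Z}_2)$; in this group the identity is the only element of order $1$, and there are exactly $21$ elements of order $2$. Hence exactly $22$ left cosets of $B$ are self-dual. 3. There are exactly $660$ self-dual $\mathcal{GR}(8,8)$ permutation sets. The dual of a $\mathcal{GR}(8,8)$ permutation set is again one, the dual of the dual of such a set is the set itself, and the sets that are not self-dual form exactly $75{,}270$ pairs $\{C,C^{-1}\}$. -/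

import Mathlib

open scoped Pointwise

namespace Garden

/-- A signed permutation matrix: every row and every column has exactly one non-zero entry, and
the non-zero entries are `1` or `-1`. -/
structure IsSignedPerm {d : ℕ} (L : Matrix (Fin d) (Fin d) ℝ) : Prop where
  row : ∀ i, ∃! j, L i j ≠ 0
  col : ∀ j, ∃! i, L i j ≠ 0
  sign : ∀ i j, L i j ≠ 0 → L i j = 1 ∨ L i j = -1

/-- `L 0, …, L (N - 1)` are signed permutation matrices of size `d × d` that satisfy the relations
of the `GR(d, N)` algebra. -/
structure IsGR (d N : ℕ) (L : Fin N → Matrix (Fin d) (Fin d) ℝ) : Prop where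
  signedPerm : ∀ I, IsSignedPerm (L I)
  mul_transpose : ∀ I J,
    L I * (L J).transpose + L J * (L I).transpose =
      (2 * (if I = J then 1 else 0) : ℝ) • (1 : Matrix (Fin d) (Fin d) ℝ)
  transpose_mul : ∀ I J,
    (L I).transpose * L J + (L J).transpose * L I =
      (2 * (if I = J then 1 else 0) : ℝ) • (1 : Matrix (Fin d) (Fin d) ℝ)

/-- The matrix of the permutation `σ`, which sends the basis vector `e_j` to `e_{σ j}`. -/
def permMat {d : ℕ} (σ : Equiv.Perm (Fin d)) : Matrix (Fin d) (Fin d) ℝ :=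
  Matrix.of fun i j => if i = σ j then 1 else 0

/-- The set of permutations `{|L_1|, …, |L_N|}`, where `|L|` is the entrywise absolute value of `L`
and permutation matrices are identified with permutations. -/
def permSet {d N : ℕ} (L : Fin N → Matrix (Fin d) (Fin d) ℝ) : Set (Equiv.Perm (Fin d)) :=
  {σ | ∃ I, (L I).map (fun x => |x|) = permMat σ}

/-- The `GR(d, N)` permutation sets: all sets `{|L_1|, …, |L_N|}` that come from signed permutation
matrices satisfying the relations of the `GR(d, N)` algebra. -/
def grPermSets (d N : ℕ) : Set (Set (Equiv.Perm (Fin d))) :=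
  {C | ∃ L : Fin N → Matrix (Fin d) (Fin d) ℝ, IsGR d N L ∧ C = permSet L}

/-- The dual `{c⁻¹ | c ∈ C}` of a set `C` of permutations. -/
def dual {d : ℕ} (C : Set (Equiv.Perm (Fin d))) : Set (Equiv.Perm (Fin d)) :=
  (fun c => c⁻¹) '' C

/-- A set of permutations is self-dual if it equals its dual. -/
def IsSelfDual {d : ℕ} (C : Set (Equiv.Perm (Fin d))) : Prop :=
  dual C = C

/-- The eight permutations `a_1, …, a_8`, with the labels `1, …, 8` replaced by `0, …, 7`. -/
def a : Fin 8 → Equiv.Perm (Fin 8) :=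
  ![1,
    Equiv.swap 0 1 * Equiv.swap 2 3 * Equiv.swap 4 5 * Equiv.swap 6 7,
    Equiv.swap 0 2 * Equiv.swap 1 3 * Equiv.swap 4 6 * Equiv.swap 5 7,
    Equiv.swap 0 4 * Equiv.swap 1 5 * Equiv.swap 2 6 * Equiv.swap 3 7,
    Equiv.swap 0 7 * Equiv.swap 1 6 * Equiv.swap 2 5 * Equiv.swap 3 4,
    Equiv.swap 0 6 * Equiv.swap 1 7 * Equiv.swap 2 4 * Equiv.swap 3 5,
    Equiv.swap 0 5 * Equiv.swap 1 4 * Equiv.swap 2 7 * Equiv.swap 3 6,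
    Equiv.swap 0 3 * Equiv.swap 1 2 * Equiv.swap 4 7 * Equiv.swap 5 6]

theorem a_mul (i j : Fin 8) : ∃ k, a k = a i * a j := by
  revert i j
  set_option maxRecDepth 100000 in decide

theorem a_inv (i : Fin 8) : ∃ k, a k = (a i)⁻¹ := by
  revert i
  set_option maxRecDepth 100000 in decide

/-- The subgroup `A = {a_1, …, a_8}` of `S_8`. -/
def A : Subgroup (Equiv.Perm (Fin 8)) where
  carrier := Set.range a
  mul_mem' := by
    rintro _ _ ⟨i, rfl⟩ ⟨j, rfl⟩
    exact a_mul i j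
  one_mem' := ⟨0, rfl⟩
  inv_mem' := by
    rintro _ ⟨i, rfl⟩
    exact a_inv i

/-- The subgroups of `S_8` conjugate to `A`. -/
def conjugatesOfA : Set (Subgroup (Equiv.Perm (Fin 8))) :=
  {B | ∃ τ : Equiv.Perm (Fin 8), B = A.map (MulAut.conj τ).toMonoidHom}

/-- The quotient group `N(B)/B`, where `N(B)` is the normalizer of `B` in `S_8`. -/
abbrev NormQuot (B : Subgroup (Equiv.Perm (Fin 8))) : Type :=
  Subgroup.normalizer (B : Set (Equiv.Perm (Fin 8))) ⧸
    B.subgroupOf (Subgroup.normalizer (B : Set (Equiv.Perm (Fin 8))))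

end Garden

namespace Garden

/-! Everything rests on regular groups of exponent two. For `I ≠ J` the relations make `L_Iᵀ L_J`
antisymmetric, so its permutation is an involution without fixed points. Eight permutations of eight
points with such quotients form a coset of a regular elementary group
(`exists_isRegularElementary`). All these groups are isomorphic to `F_2^3`, and an isomorphism of
regular groups is a conjugation, so they are exactly the conjugates of `A`. Conversely, left
multiplications by the basis octonions realise `A`, and permuting rows and columns realises every
coset.

Such a group `B` is its own centralizer, and every automorphism comes from its normalizer, so
`N(B)/B ≅ Aut(F_2^3) ≅ SL_3(F_2)`, of order 168. Thus `|N(A)| = 8 · 168`, which gives 30 conjugates.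
A coset `πB` is closed under inversion iff it is an element of `N(B)/B` with square 1
(`inv_smul_coe_eq_iff`). A coset determines its subgroup, so the counts for the 30 groups add up. -/

/-- A group of permutations of exponent at most two that acts simply transitively. -/
structure IsRegularElementary {X : Type*} (B : Subgroup (Equiv.Perm X)) : Prop where
  sq : ∀ b ∈ B, b * b = 1
  regular : ∀ x, Function.Bijective (fun b : B => (b : Equiv.Perm X) x)

/-! ### Regular groups of exponent two: conjugacy, normalizers, structure. -/

namespace IsRegularElementary

variable {X : Type*} {B B' : Subgroup (Equiv.Perm X)}

theorem mul_comm (hB : IsRegularElementary B) {b c : Equiv.Perm X} (hb : b ∈ B) (hc : c ∈ B) :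
    b * c = c * b := by
  have h := hB.sq _ (B.mul_mem hb hc)
  have hb' : b⁻¹ = b := inv_eq_of_mul_eq_one_left (hB.sq b hb)
  have hc' : c⁻¹ = c := inv_eq_of_mul_eq_one_left (hB.sq c hc)
  calc b * c = (b * c)⁻¹ := (inv_eq_of_mul_eq_one_left h).symm
    _ = c * b := by rw [mul_inv_rev, hb', hc']

theorem card_eq (hB : IsRegularElementary B) [Nonempty X] : Nat.card B = Nat.card X :=
  Nat.card_congr (Equiv.ofBijective _ (hB.regular (Classical.arbitrary X)))

/-- An isomorphism of regular groups is induced by a conjugation. -/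
theorem exists_conj [Nonempty X] (hB : IsRegularElementary B) (hB' : IsRegularElementary B')
    (φ : B ≃* B') :
    ∃ τ : Equiv.Perm X, ∀ b : B, τ * b * τ⁻¹ = (φ b : Equiv.Perm X) := by
  let x₀ : X := Classical.arbitrary X
  let e := Equiv.ofBijective _ (hB.regular x₀)
  let e' := Equiv.ofBijective _ (hB'.regular x₀)
  -- The orbit maps of `x₀` identify both groups with `X`; `τ` is `φ` read through them.
  let τ : Equiv.Perm X := e.symm.trans (φ.toEquiv.trans e')
  have hτ (b : B) : τ ((b : Equiv.Perm X) x₀) = (φ b : Equiv.Perm X) x₀ := by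
    have : e.symm ((b : Equiv.Perm X) x₀) = b := e.symm_apply_apply b
    simp only [τ, Equiv.trans_apply, this]
    rfl
  refine ⟨τ, fun b => ?_⟩
  rw [mul_inv_eq_iff_eq_mul]
  ext y
  obtain ⟨c, rfl⟩ := (hB.regular x₀).2 y
  simpa [hτ] using hτ (b * c)

theorem map_conj (hB : IsRegularElementary B) (τ : Equiv.Perm X) :
    IsRegularElementary (B.map (MulAut.conj τ).toMonoidHom) where
  sq := by
    rintro _ ⟨b, hb, rfl⟩
    rw [← map_mul, hB.sq b hb, map_one]
  regular x := by
    constructor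
    · rintro ⟨_, b, hb, rfl⟩ ⟨_, c, hc, rfl⟩ h
      have h' : b (τ⁻¹ x) = c (τ⁻¹ x) := by simpa using h
      have := (hB.regular (τ⁻¹ x)).1 (a₁ := ⟨b, hb⟩) (a₂ := ⟨c, hc⟩) h'
      simp_all
    · intro y
      obtain ⟨⟨b, hb⟩, h⟩ := (hB.regular (τ⁻¹ x)).2 (τ⁻¹ y)
      refine ⟨⟨_, b, hb, rfl⟩, ?_⟩
      simpa [Equiv.Perm.inv_def, Equiv.eq_symm_apply] using h

theorem map_conj_eq_of_mulEquiv [Nonempty X] (hB : IsRegularElementary B)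
    (hB' : IsRegularElementary B') (φ : B ≃* B') :
    ∃ τ : Equiv.Perm X, B' = B.map (MulAut.conj τ).toMonoidHom := by
  obtain ⟨τ, hτ⟩ := hB.exists_conj hB' φ
  refine ⟨τ, ?_⟩
  ext c
  constructor
  · intro hc
    refine ⟨φ.symm ⟨c, hc⟩, (φ.symm ⟨c, hc⟩).2, ?_⟩
    simpa using hτ (φ.symm ⟨c, hc⟩)
  · rintro ⟨b, hb, rfl⟩
    have := hτ ⟨b, hb⟩
    simp only [MulEquiv.toMonoidHom_eq_coe, MonoidHom.coe_coe, MulAut.conj_apply]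
    rw [this]
    exact (φ ⟨b, hb⟩).2

/-- A permutation that commutes with a transitive group is determined by its value at one point, and
the abelian group `B` has an element with any prescribed value there. -/
theorem centralizer_le [Nonempty X] (hB : IsRegularElementary B) :
    Subgroup.centralizer (B : Set (Equiv.Perm X)) ≤ B := by
  intro g hg
  let x₀ : X := Classical.arbitrary X
  obtain ⟨⟨b, hb⟩, h⟩ := (hB.regular x₀).2 (g x₀)
  have : g = b := by
    ext y
    obtain ⟨⟨c, hc⟩, rfl⟩ := (hB.regular x₀).2 y
    have h1 := Subgroup.mem_centralizer_iff.1 hg c hc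
    have h2 := hB.mul_comm hc hb
    have h3 := congrArg (fun σ : Equiv.Perm X => σ x₀) h1
    have h4 := congrArg (fun σ : Equiv.Perm X => σ x₀) h2
    simp only [Equiv.Perm.mul_apply] at h h3 h4 ⊢
    rw [← h3, ← h4, h]
  rwa [this]

theorem normalizerMonoidHom_ker (hB : IsRegularElementary B) [Nonempty X] :
    B.normalizerMonoidHom.ker =
      B.subgroupOf (Subgroup.normalizer (B : Set (Equiv.Perm X))) := by
  rw [Subgroup.normalizerMonoidHom_ker]
  congr 1
  refine le_antisymm hB.centralizer_le fun b hb => ?_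
  exact Subgroup.mem_centralizer_iff.2 fun c hc => hB.mul_comm hc hb

theorem normalizerMonoidHom_surjective (hB : IsRegularElementary B) [Nonempty X] :
    Function.Surjective B.normalizerMonoidHom := by
  intro φ
  obtain ⟨τ, hτ⟩ := hB.exists_conj hB φ
  have hmem : τ ∈ Subgroup.normalizer (B : Set (Equiv.Perm X)) := by
    rw [Subgroup.mem_normalizer_iff]
    intro b
    constructor
    · intro hb
      have := hτ ⟨b, hb⟩
      dsimp only at this
      rw [this]
      exact (φ ⟨b, hb⟩).2
    · intro hb
      have h := hτ (φ.symm ⟨_, hb⟩)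
      simp only [MulEquiv.apply_symm_apply, mul_left_inj, mul_right_inj] at h
      rw [← h]
      exact (φ.symm ⟨_, hb⟩).2
  refine ⟨⟨τ, hmem⟩, ?_⟩
  ext b : 2
  exact hτ b

/-- The quotient of the normalizer of a regular elementary group is its automorphism group. -/
noncomputable def normQuotEquiv (hB : IsRegularElementary B) [Nonempty X] :
    (Subgroup.normalizer (B : Set (Equiv.Perm X)) ⧸
      B.subgroupOf (Subgroup.normalizer (B : Set (Equiv.Perm X)))) ≃* MulAut B :=
  (QuotientGroup.quotientMulEquivOfEq hB.normalizerMonoidHom_ker.symm).trans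
    (QuotientGroup.quotientKerEquivOfSurjective _ hB.normalizerMonoidHom_surjective)

/-- A regular elementary group on `2 ^ n` points is a vector space of dimension `n`. -/
theorem nonempty_mulEquiv (hB : IsRegularElementary B) {n : ℕ} (hX : Nat.card X = 2 ^ n) :
    Nonempty (B ≃* Multiplicative (Fin n → ZMod 2)) := by
  have hX0 : Nat.card X ≠ 0 := by rw [hX]; positivity
  have : Nonempty X := (Nat.card_ne_zero.1 hX0).1
  have hcard := hB.card_eq
  have : Finite B := (Nat.card_ne_zero.1 (hcard ▸ hX0)).2
  let _ : CommGroup B :=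
    { (inferInstance : Group B) with
      mul_comm := fun b c => Subtype.ext (hB.mul_comm b.2 c.2) }
  let _ : Module (ZMod 2) (Additive B) := AddCommGroup.zmodModule (n := 2) fun b => by
    rw [two_nsmul]
    exact Subtype.ext (hB.sq _ b.toMul.2)
  have hfin : Finite (Additive B) := ‹Finite B›
  have hrank : Module.finrank (ZMod 2) (Additive B) = n := by
    have h := Module.natCard_eq_pow_finrank (K := ZMod 2) (V := Additive B)
    rw [Nat.card_zmod] at h
    have h' : Nat.card (Additive B) = 2 ^ n := hcard.trans hX
    exact Nat.pow_right_injective le_rfl (h.symm.trans h')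
  let e : Additive B ≃ₗ[ZMod 2] (Fin n → ZMod 2) :=
    LinearEquiv.ofFinrankEq _ _ (by simp [hrank])
  exact ⟨AddEquiv.toMultiplicativeRight e.toAddEquiv⟩

end IsRegularElementary

/-! ### Automorphisms of `F_2^n` and the group `SL_3(F_2)`. -/

/-- Additive automorphisms of a vector space over a prime field are linear. -/
def addAutEquivLinear (n : ℕ) (V : Type*) [AddCommGroup V] [Module (ZMod n) V] :
    Multiplicative (AddAut V) ≃* (V ≃ₗ[ZMod n] V) where
  toFun f := { f.toAdd with map_smul' := fun c x => ZMod.map_smul f.toAdd.toAddMonoidHom c x }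
  invFun f := Multiplicative.ofAdd f.toAddEquiv
  left_inv _ := rfl
  right_inv _ := rfl
  map_mul' _ _ := rfl

theorem det_eq_one_of_zmod_two {n : ℕ} (M : GL (Fin n) (ZMod 2)) : M.val.det = 1 := by
  have h : IsUnit M.val.det := M.isUnit.map Matrix.detMonoidHom
  generalize M.val.det = x at h
  revert x
  decide

/-- Over the field with two elements, the special linear group is the general linear group. -/
noncomputable def specialEquivGeneral (n : ℕ) :
    Matrix.SpecialLinearGroup (Fin n) (ZMod 2) ≃* GL (Fin n) (ZMod 2) :=
  MulEquiv.ofBijective Matrix.SpecialLinearGroup.toGL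
    ⟨Matrix.SpecialLinearGroup.toGL_injective, fun M =>
      ⟨⟨M, det_eq_one_of_zmod_two M⟩, Units.ext rfl⟩⟩

noncomputable def mulAutEquivSpecial (n : ℕ) :
    MulAut (Multiplicative (Fin n → ZMod 2)) ≃* Matrix.SpecialLinearGroup (Fin n) (ZMod 2) :=
  (MulAutMultiplicative _).trans <| (addAutEquivLinear 2 _).trans <|
    (LinearMap.GeneralLinearGroup.generalLinearEquiv _ _).symm.trans <|
      Matrix.GeneralLinearGroup.toLin.symm.trans (specialEquivGeneral n).symm

theorem card_special_three : Nat.card (Matrix.SpecialLinearGroup (Fin 3) (ZMod 2)) = 168 := by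
  rw [Nat.card_congr (specialEquivGeneral 3).toEquiv, Matrix.card_GL_field]
  simp [Fin.prod_univ_succ]

/-- A matrix with square 1 is invertible, so the search can run over all 512 matrices without a
determinant condition. -/
theorem card_involutive_matrices :
    (Finset.univ.filter fun M : Matrix (Fin 3) (Fin 3) (ZMod 2) => M * M = 1 ∧ M ≠ 1).card = 21 := by
  decide +kernel

theorem ncard_orderOf_two_special :
    {M : Matrix.SpecialLinearGroup (Fin 3) (ZMod 2) | orderOf M = 2}.ncard = 21 := by
  have hinj : Function.Injective
      fun M : Matrix.SpecialLinearGroup (Fin 3) (ZMod 2) => M.val := Subtype.val_injective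
  rw [← card_involutive_matrices, ← Set.ncard_coe_finset, ← Set.ncard_image_of_injective _ hinj]
  congr 1
  ext M
  simp only [Set.mem_image, Set.mem_ofPred_eq, orderOf_eq_prime_iff, Finset.coe_filter,
    Finset.mem_univ, true_and, pow_two]
  constructor
  · rintro ⟨M, ⟨h1, h2⟩, rfl⟩
    refine ⟨by simpa using congrArg Subtype.val h1, fun h => h2 (Subtype.ext h)⟩
  · rintro ⟨h1, h2⟩
    let U : GL (Fin 3) (ZMod 2) := ⟨M, M, h1, h1⟩
    exact ⟨⟨M, det_eq_one_of_zmod_two U⟩, ⟨Subtype.ext h1, fun h => h2 (congrArg Subtype.val h)⟩, rfl⟩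

/-! ### The conjugates of `A` and their normalizer quotients. -/

theorem isRegularElementary_A : IsRegularElementary A where
  sq := by
    rintro _ ⟨i, rfl⟩
    revert i
    decide +kernel
  regular x := by
    constructor
    · rintro ⟨_, i, rfl⟩ ⟨_, j, rfl⟩ h
      have key : ∀ x i j, a i x = a j x → i = j := by decide +kernel
      obtain rfl := key x i j h
      rfl
    · intro y
      have key : ∀ x y, ∃ i, a i x = y := by decide +kernel
      obtain ⟨i, hi⟩ := key x y
      exact ⟨⟨_, i, rfl⟩, hi⟩

theorem mem_conjugatesOfA_iff {B : Subgroup (Equiv.Perm (Fin 8))} :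
    B ∈ conjugatesOfA ↔ IsRegularElementary B := by
  constructor
  · rintro ⟨τ, rfl⟩
    exact isRegularElementary_A.map_conj τ
  · intro hB
    obtain ⟨e⟩ := hB.nonempty_mulEquiv (n := 3) (by simp)
    obtain ⟨f⟩ := isRegularElementary_A.nonempty_mulEquiv (n := 3) (by simp)
    exact isRegularElementary_A.map_conj_eq_of_mulEquiv hB (f.trans e.symm)

theorem nonempty_normQuot_equiv {B : Subgroup (Equiv.Perm (Fin 8))} (hB : B ∈ conjugatesOfA) :
    Nonempty (NormQuot B ≃* Matrix.SpecialLinearGroup (Fin 3) (ZMod 2)) := by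
  have hB := mem_conjugatesOfA_iff.1 hB
  obtain ⟨e⟩ := hB.nonempty_mulEquiv (n := 3) (by simp)
  exact ⟨hB.normQuotEquiv.trans ((MulAut.congr e).trans (mulAutEquivSpecial 3))⟩

theorem ncard_orderOf_two {B : Subgroup (Equiv.Perm (Fin 8))} (hB : B ∈ conjugatesOfA) :
    {q : NormQuot B | orderOf q = 2}.ncard = 21 := by
  obtain ⟨e⟩ := nonempty_normQuot_equiv hB
  rw [← ncard_orderOf_two_special, ← Set.ncard_image_of_injective _ e.injective]
  congr 1
  ext M
  constructor
  · rintro ⟨q, hq, rfl⟩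
    exact (MulEquiv.orderOf_eq e q).trans hq
  · intro hM
    exact ⟨e.symm M, (MulEquiv.orderOf_eq e.symm M).trans hM, e.apply_symm_apply M⟩

theorem card_of_mem_conjugatesOfA {B : Subgroup (Equiv.Perm (Fin 8))} (hB : B ∈ conjugatesOfA) :
    Nat.card B = 8 := by
  simpa using (mem_conjugatesOfA_iff.1 hB).card_eq

theorem A_mem_conjugatesOfA : A ∈ conjugatesOfA := mem_conjugatesOfA_iff.2 isRegularElementary_A

theorem card_normalizer_A :
    Nat.card (Subgroup.normalizer (A : Set (Equiv.Perm (Fin 8)))) = 1344 := by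
  obtain ⟨e⟩ := nonempty_normQuot_equiv A_mem_conjugatesOfA
  rw [Subgroup.card_eq_card_quotient_mul_card_subgroup
    (A.subgroupOf (Subgroup.normalizer (A : Set (Equiv.Perm (Fin 8))))),
    Nat.card_congr e.toEquiv, card_special_three,
    Nat.card_congr (Subgroup.subgroupOfEquivOfLe Subgroup.le_normalizer).toEquiv,
    card_of_mem_conjugatesOfA A_mem_conjugatesOfA]

/-- Orbit-stabilizer for conjugation: the stabilizer of `A` is its normalizer, and `40320 / 1344 =
30`. -/
theorem ncard_conjugatesOfA : conjugatesOfA.ncard = 30 := by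
  have horbit : conjugatesOfA = MulAction.orbit (ConjAct (Equiv.Perm (Fin 8))) A := by
    ext B
    constructor
    · rintro ⟨τ, rfl⟩
      exact ⟨ConjAct.toConjAct τ, rfl⟩
    · rintro ⟨τ, rfl⟩
      exact ⟨ConjAct.ofConjAct τ, rfl⟩
  have hstab : Nat.card (MulAction.stabilizer (ConjAct (Equiv.Perm (Fin 8))) A) = 1344 := by
    rw [← card_normalizer_A]
    refine Nat.card_congr (ConjAct.ofConjAct.toEquiv.subtypeEquiv fun g => ?_)
    exact Subgroup.conjAct_pointwise_smul_iff
  have h := Nat.card_congr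
    (MulAction.orbitProdStabilizerEquivGroup (ConjAct (Equiv.Perm (Fin 8))) A)
  have hG : Nat.card (ConjAct (Equiv.Perm (Fin 8))) = 40320 := by
    rw [Nat.card_congr ConjAct.ofConjAct.toEquiv, Nat.card_perm, Nat.card_fin]
    norm_num [Nat.factorial]
  refine Nat.eq_of_mul_eq_mul_right (show 0 < 1344 by norm_num) ?_
  calc conjugatesOfA.ncard * 1344 = 40320 := by
        rw [← hG, ← h, Nat.card_prod, hstab, ← horbit, Nat.card_coe_set_eq]
    _ = 30 * 1344 := by norm_num

/-! ### Signed permutation matrices and the octonionic realisation. -/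

theorem permMat_injective {d : ℕ} : Function.Injective (permMat (d := d)) := by
  intro σ ρ h
  ext j : 1
  have := congrFun (congrFun h (σ j)) j
  simpa [permMat] using this

/-- The absolute value of a signed permutation matrix is a permutation matrix. -/
theorem IsSignedPerm.exists_perm {d : ℕ} {L : Matrix (Fin d) (Fin d) ℝ} (hL : IsSignedPerm L) :
    ∃ σ : Equiv.Perm (Fin d), (∀ i j, L i j ≠ 0 ↔ i = σ j) ∧ L.map (fun x => |x|) = permMat σ := by
  choose f hf hfu using hL.col
  have hinj : Function.Injective f := fun j k h =>
    (hL.row (f j)).unique (hf j) (h ▸ hf k)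
  let σ : Equiv.Perm (Fin d) := Equiv.ofBijective f hinj.bijective_of_finite
  have hσ (i j) : L i j ≠ 0 ↔ i = σ j :=
    ⟨fun h => hfu j i h, fun h => h ▸ hf j⟩
  refine ⟨σ, hσ, ?_⟩
  ext i j
  simp only [Matrix.map_apply, permMat, Matrix.of_apply]
  split_ifs with h
  · rcases hL.sign i j ((hσ i j).2 h) with h | h <;> simp [h]
  · simpa using fun h0 => h ((hσ i j).1 h0)

/-- Reordering the rows and the columns preserves the `GR` relations. -/
theorem IsGR.submatrix {d N : ℕ} {L : Fin N → Matrix (Fin d) (Fin d) ℝ} (hL : IsGR d N L)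
    (σ τ : Equiv.Perm (Fin d)) : IsGR d N fun I => (L I).submatrix σ τ where
  signedPerm I :=
    { row := fun i => (τ.bijective.existsUnique_iff (p := fun j => L I (σ i) j ≠ 0)).1
        ((hL.signedPerm I).row (σ i))
      col := fun j => (σ.bijective.existsUnique_iff (p := fun i => L I i (τ j) ≠ 0)).1
        ((hL.signedPerm I).col (τ j))
      sign := fun i j => (hL.signedPerm I).sign (σ i) (τ j) }
  mul_transpose I J := by
    have h := congrArg (fun M => M.submatrix σ σ) (hL.mul_transpose I J)
    split_ifs at h ⊢ <;> simpa [Matrix.transpose_submatrix, Matrix.submatrix_mul_equiv, Matrix.submatrix_add,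
      Matrix.submatrix_smul] using h
  transpose_mul I J := by
    have h := congrArg (fun M => M.submatrix τ τ) (hL.transpose_mul I J)
    split_ifs at h ⊢ <;> simpa [Matrix.transpose_submatrix, Matrix.submatrix_mul_equiv, Matrix.submatrix_add,
      Matrix.submatrix_smul] using h

theorem permSet_submatrix {d N : ℕ} (L : Fin N → Matrix (Fin d) (Fin d) ℝ)
    (σ τ : Equiv.Perm (Fin d)) :
    permSet (fun I => (L I).submatrix σ.symm τ) = (fun ρ => σ * ρ * τ) '' permSet L := by
  have key (ρ : Equiv.Perm (Fin d)) : permMat (σ * ρ * τ) = (permMat ρ).submatrix σ.symm τ := by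
    ext i j
    simp only [permMat, Matrix.submatrix_apply, Matrix.of_apply, Equiv.symm_apply_eq,
      Equiv.Perm.mul_apply]
    congr
  ext ρ
  constructor
  · rintro ⟨I, hI⟩
    refine ⟨σ⁻¹ * ρ * τ⁻¹, ⟨I, ?_⟩, by group⟩
    have hρ : ρ = σ * (σ⁻¹ * ρ * τ⁻¹) * τ := by group
    rw [hρ, key] at hI
    ext i j
    simpa using congrFun (congrFun hI (σ i)) (τ.symm j)
  · rintro ⟨ρ, ⟨I, hI⟩, rfl⟩
    refine ⟨I, ?_⟩
    rw [key, ← hI]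
    rfl

/-- The signs in the multiplication table of the octonions. -/
def octonionSign : Fin 8 → Fin 8 → ℤ :=
  ![![1, 1, 1, 1, 1, 1, 1, 1],
    ![1, -1, 1, -1, 1, -1, -1, 1],
    ![1, -1, -1, 1, 1, 1, -1, -1],
    ![1, -1, -1, -1, -1, 1, 1, 1],
    ![1, -1, 1, 1, -1, -1, 1, -1],
    ![1, 1, 1, -1, -1, 1, -1, -1],
    ![1, 1, -1, 1, -1, -1, -1, 1],
    ![1, 1, -1, -1, 1, -1, 1, -1]]

theorem octonionSign_eq (I j : Fin 8) : octonionSign I j = 1 ∨ octonionSign I j = -1 := by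
  revert I j
  decide +kernel

/-- The two products are the `(x, y)` and `(y, x)` entries of `L_Iᵀ L_J`, so this is its
antisymmetry, checked on the table. -/
theorem octonionSign_anticomm (I J : Fin 8) (hIJ : I ≠ J) (x y : Fin 8) (h : a I x = a J y) :
    a I y = a J x ∧
      octonionSign I x * octonionSign J y = -(octonionSign I y * octonionSign J x) := by
  revert I J x y
  decide +kernel

/-- The matrices of the left multiplications by the basis octonions. -/
def octonionMat (I : Fin 8) : Matrix (Fin 8) (Fin 8) ℝ :=
  Matrix.of fun i j => if i = a I j then (octonionSign I j : ℝ) else 0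

theorem octonionMat_ne_zero_iff (I i j : Fin 8) : octonionMat I i j ≠ 0 ↔ i = a I j := by
  rcases octonionSign_eq I j with h | h <;> simp [octonionMat, h]

theorem octonionMat_transpose_mul_apply (I J x y : Fin 8) :
    ((octonionMat I).transpose * octonionMat J) x y =
      if a I x = a J y then (octonionSign I x * octonionSign J y : ℝ) else 0 := by
  simp [Matrix.mul_apply, octonionMat, eq_comm (a := a J y)]

/-- The first half of the `GR` relations implies the second half when the matrices are square. -/
theorem mul_transpose_of_transpose_mul {d N : ℕ} {L : Fin N → Matrix (Fin d) (Fin d) ℝ}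
    (hL : ∀ I J, (L I).transpose * L J + (L J).transpose * L I =
      (2 * (if I = J then 1 else 0) : ℝ) • (1 : Matrix (Fin d) (Fin d) ℝ)) (I J : Fin N) :
    L I * (L J).transpose + L J * (L I).transpose =
      (2 * (if I = J then 1 else 0) : ℝ) • (1 : Matrix (Fin d) (Fin d) ℝ) := by
  have hone (I : Fin N) : L I * (L I).transpose = 1 := by
    have h := hL I I
    rw [if_pos rfl, mul_one, ← two_smul ℝ] at h
    exact mul_eq_one_comm.1 (smul_right_injective _ (two_ne_zero (α := ℝ)) h)
  by_cases hIJ : I = J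
  · subst hIJ
    rw [hone, if_pos rfl, mul_one, two_smul]
  -- Since `L_I L_Iᵀ = 1`, conjugating `L_Iᵀ L_J + L_Jᵀ L_I` by `L_I` gives `L_J L_Iᵀ + L_I L_Jᵀ`.
  · have h := congrArg (fun M => L I * M * (L I).transpose) (hL I J)
    simp only [if_neg hIJ, mul_zero, zero_smul, zero_mul, mul_add, add_mul] at h ⊢
    rw [← Matrix.mul_assoc, hone, one_mul, ← Matrix.mul_assoc, Matrix.mul_assoc (_ * _), hone,
      mul_one] at h
    rw [add_comm, h]

theorem octonionMat_transpose_mul (I J : Fin 8) :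
    (octonionMat I).transpose * octonionMat J + (octonionMat J).transpose * octonionMat I =
      (2 * (if I = J then 1 else 0) : ℝ) • (1 : Matrix (Fin 8) (Fin 8) ℝ) := by
  ext x y
  rw [Matrix.add_apply, octonionMat_transpose_mul_apply, octonionMat_transpose_mul_apply]
  by_cases hIJ : I = J
  · subst hIJ
    by_cases hxy : x = y
    · subst hxy
      rcases octonionSign_eq I x with h | h <;> norm_num [h]
    · simp [hxy]
  · by_cases h : a I x = a J y
    · obtain ⟨h1, h2⟩ := octonionSign_anticomm I J hIJ x y h
      have h3 : (octonionSign I x * octonionSign J y : ℝ) =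
          -(octonionSign I y * octonionSign J x) := by exact_mod_cast h2
      simp [h, h1, h3, hIJ, mul_comm]
    · have h' : a J x ≠ a I y := fun h1 =>
        h (octonionSign_anticomm I J hIJ y x h1.symm).1
      simp [h, h', hIJ]

theorem isGR_octonionMat : IsGR 8 8 octonionMat where
  signedPerm I :=
    { row := fun i => by
        refine ⟨(a I).symm i, (octonionMat_ne_zero_iff _ _ _).2 (by simp), fun j hj => ?_⟩
        simp [(octonionMat_ne_zero_iff _ _ _).1 hj]
      col := fun j =>
        ⟨a I j, (octonionMat_ne_zero_iff _ _ _).2 rfl,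
          fun i hi => (octonionMat_ne_zero_iff _ _ _).1 hi⟩
      sign := fun i j h => by
        have h' := (octonionMat_ne_zero_iff _ _ _).1 h
        rcases octonionSign_eq I j with hs | hs <;> simp [octonionMat, h', hs] }
  mul_transpose := mul_transpose_of_transpose_mul octonionMat_transpose_mul
  transpose_mul := octonionMat_transpose_mul

theorem permSet_octonionMat :
    permSet octonionMat = (A : Set (Equiv.Perm (Fin 8))) := by
  have key (I : Fin 8) :
      (octonionMat I).map (fun x => |x|) = permMat (a I) := by
    ext i j
    rcases octonionSign_eq I j with h | h <;>
      by_cases hij : i = a I j <;> simp [octonionMat, permMat, h, hij]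
  ext σ
  change (∃ I, _ = _) ↔ σ ∈ Set.range a
  simp only [key, Set.mem_range, permMat_injective.eq_iff]

/-- The coset is `(πτ) A τ⁻¹`, so reordering rows and columns of the octonion matrices produces it.
-/
theorem smul_mem_grPermSets {B : Subgroup (Equiv.Perm (Fin 8))}
    (hB : B ∈ conjugatesOfA) (π : Equiv.Perm (Fin 8)) :
    π • (B : Set (Equiv.Perm (Fin 8))) ∈ grPermSets 8 8 := by
  obtain ⟨τ, rfl⟩ := hB
  refine ⟨_, isGR_octonionMat.submatrix (π * τ).symm τ⁻¹, ?_⟩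
  rw [permSet_submatrix, permSet_octonionMat]
  ext ρ
  simp [Set.mem_smul_set, mul_assoc]

/-! ### From the relations to cosets of regular groups. -/

/-- In a `GR(d, N)` algebra with `I ≠ J`, the matrix `L_Iᵀ L_J` is antisymmetric; its permutation
is an involution without fixed points. -/
theorem IsGR.perm_apply_eq {d N : ℕ} {L : Fin N → Matrix (Fin d) (Fin d) ℝ} (hL : IsGR d N L)
    {σ : Fin N → Equiv.Perm (Fin d)} (hσ : ∀ I i j, L I i j ≠ 0 ↔ i = σ I j) {I J : Fin N}
    (hIJ : I ≠ J) {x y : Fin d} (h : σ I x = σ J y) : x ≠ y ∧ σ I y = σ J x := by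
  have entry (x y : Fin d) :
      ((L I).transpose * L J) x y = L I (σ I x) x * L J (σ I x) y := by
    rw [Matrix.mul_apply]
    refine Finset.sum_eq_single (σ I x) (fun k _ hk => ?_) (by simp)
    rw [Matrix.transpose_apply, not_not.1 fun h0 => hk ((hσ I k x).1 h0), zero_mul]
  have hanti (x y : Fin d) :
      ((L I).transpose * L J) x y + ((L I).transpose * L J) y x = 0 := by
    have h1 := congrFun (congrFun (hL.transpose_mul I J) x) y
    have h2 : (L J).transpose * L I = ((L I).transpose * L J).transpose := by simp
    rw [h2, if_neg hIJ, mul_zero, zero_smul] at h1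
    exact h1
  have hne : ((L I).transpose * L J) x y ≠ 0 := by
    rw [entry]
    exact mul_ne_zero ((hσ _ _ _).2 rfl) ((hσ _ _ _).2 h)
  have h0 := hanti x y
  constructor
  · rintro rfl
    exact hne (by linarith)
  · have hne' : ((L I).transpose * L J) y x ≠ 0 := fun h' => hne (by linarith)
    rw [entry] at hne'
    exact (hσ _ _ _).1 (right_ne_zero_of_mul hne')

/-- Permutations whose quotients are involutions without fixed points, as many as there are points,
form a coset of a regular elementary group. -/
theorem exists_isRegularElementary {ι X : Type*} [Finite ι] [Nonempty ι]
    (hcard : Nat.card ι = Nat.card X) (σ : ι → Equiv.Perm X)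
    (hσ : ∀ i j, i ≠ j → ∀ x y, σ i x = σ j y → x ≠ y ∧ σ i y = σ j x) :
    ∃ B : Subgroup (Equiv.Perm X), IsRegularElementary B ∧
      ∃ π : Equiv.Perm X, Set.range σ = π • (B : Set (Equiv.Perm X)) := by
  let o : ι := Classical.arbitrary ι
  let ρ : ι → Equiv.Perm X := fun i => (σ o)⁻¹ * σ i
  have : Finite X := (Nat.card_ne_zero.1 (hcard ▸ Nat.card_pos.ne')).2
  -- Distinct `ρ i`, `ρ j` agree at no point, and there are as many indices as points.
  have hbij (x : X) : Function.Bijective fun i => ρ i x := by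
    refine (Nat.bijective_iff_injective_and_card _).2 ⟨fun i j h => ?_, hcard⟩
    by_contra hij
    exact (hσ i j hij x x (by simpa [ρ] using h)).1 rfl
  have hinv (i j : ι) : (ρ i)⁻¹ * ρ j = (ρ j)⁻¹ * ρ i := by
    by_cases hij : i = j
    · rw [hij]
    ext x
    have h := (hσ i j hij (((ρ i)⁻¹ * ρ j) x) x (by simp [ρ])).2
    rw [Equiv.Perm.mul_apply (ρ j)⁻¹, Equiv.Perm.eq_inv_iff_eq]
    simp only [ρ, Equiv.Perm.mul_apply] at h ⊢
    rw [h]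
  have ho : ρ o = 1 := by simp [ρ]
  have hsymm (i : ι) : (ρ i)⁻¹ = ρ i := by simpa [ho] using hinv i o
  have hcomm (i j : ι) : ρ i * ρ j = ρ j * ρ i := by simpa [hsymm] using hinv i j
  have hmul (i j : ι) : ∃ k, ρ k = ρ i * ρ j := by
    rcases isEmpty_or_nonempty X with hX | ⟨⟨x⟩⟩
    · exact ⟨o, Subsingleton.elim _ _⟩
    -- `ρ k` is chosen to agree with the product at `x`. Both commute with the transitive family
    -- `ρ`, so they agree everywhere.
    obtain ⟨k, hk⟩ := (hbij x).2 ((ρ i * ρ j) x)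
    refine ⟨k, ?_⟩
    ext y
    obtain ⟨m, rfl⟩ := (hbij x).2 y
    have h1 : (ρ i * ρ j) * ρ m = ρ m * (ρ i * ρ j) := by
      rw [mul_assoc, hcomm j m, ← mul_assoc, hcomm i m, mul_assoc]
    dsimp only at hk ⊢
    rw [← Equiv.Perm.mul_apply (ρ k), hcomm, Equiv.Perm.mul_apply, hk,
      ← Equiv.Perm.mul_apply (ρ m), ← h1, Equiv.Perm.mul_apply]
  let B : Subgroup (Equiv.Perm X) :=
    { carrier := Set.range ρ
      mul_mem' := by
        rintro _ _ ⟨i, rfl⟩ ⟨j, rfl⟩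
        exact hmul i j
      one_mem' := ⟨o, ho⟩
      inv_mem' := by
        rintro _ ⟨i, rfl⟩
        exact ⟨i, (hsymm i).symm⟩ }
  refine ⟨B, ⟨?_, fun x => ⟨?_, fun y => ?_⟩⟩, σ o, ?_⟩
  · rintro _ ⟨i, rfl⟩
    nth_rewrite 1 [← hsymm i]
    exact inv_mul_cancel _
  · rintro ⟨_, i, rfl⟩ ⟨_, j, rfl⟩ h
    obtain rfl := (hbij x).1 h
    rfl
  · obtain ⟨i, hi⟩ := (hbij x).2 y
    exact ⟨⟨_, i, rfl⟩, hi⟩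
  · change _ = σ o • Set.range ρ
    rw [Set.smul_set_range]
    simp [ρ]

theorem mem_grPermSets_iff (C : Set (Equiv.Perm (Fin 8))) :
    C ∈ grPermSets 8 8 ↔ ∃ B ∈ conjugatesOfA, ∃ π : Equiv.Perm (Fin 8),
      C = π • (B : Set (Equiv.Perm (Fin 8))) := by
  constructor
  · rintro ⟨L, hL, rfl⟩
    choose σ hσ hperm using fun I => (hL.signedPerm I).exists_perm
    obtain ⟨B, hB, π, hπ⟩ := exists_isRegularElementary rfl σ
      fun I J hIJ x y h => hL.perm_apply_eq hσ hIJ h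
    refine ⟨B, mem_conjugatesOfA_iff.2 hB, π, ?_⟩
    rw [← hπ]
    ext ρ
    change (∃ I, _ = _) ↔ _
    simp only [hperm, Set.mem_range, permMat_injective.eq_iff]
  · rintro ⟨B, hB, π, rfl⟩
    exact smul_mem_grPermSets hB π

/-! ### Counting disjoint unions and pairs of an involution. -/

theorem ncard_biUnion_const {α β : Type*} [Finite β] {S : Set α} (hS : S.Finite) (f : α → Set β)
    (hf : S.PairwiseDisjoint f) {k : ℕ} (hk : ∀ x ∈ S, (f x).ncard = k) :
    (⋃ x ∈ S, f x).ncard = S.ncard * k := by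
  classical
  have := Fintype.ofFinite β
  have hU : (⋃ x ∈ S, f x) = ((hS.toFinset.biUnion fun x => (f x).toFinset : Finset β) : Set β) := by
    ext y
    simp
  have hdisj : (hS.toFinset : Set α).PairwiseDisjoint fun x => (f x).toFinset := by
    intro x hx y hy hxy
    exact Set.disjoint_toFinset.2 (hf (by simpa using hx) (by simpa using hy) hxy)
  rw [hU, Set.ncard_coe_finset, Finset.card_biUnion hdisj, Set.ncard_eq_toFinset_card S hS,
    Finset.sum_const_nat]
  intro x hx
  rw [← hk x (by simpa using hx), Set.ncard_eq_toFinset_card']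

/-- The pairs formed by the points that an involution moves. -/
theorem two_mul_ncard_pairs {α : Type*} [Finite α] {T : Set α} {f : α → α}
    (hT : ∀ x ∈ T, f x ∈ T ∧ f x ≠ x ∧ f (f x) = x) :
    {P : Sym2 α | ∃ x ∈ T, P = s(x, f x)}.ncard * 2 = T.ncard := by
  have hU : (⋃ P ∈ {P : Sym2 α | ∃ x ∈ T, P = s(x, f x)}, {x | x ∈ P}) = T := by
    ext x
    simp only [Set.mem_ofPred_eq, Set.mem_iUnion, exists_prop]
    constructor
    · rintro ⟨_, ⟨y, hy, rfl⟩, hx⟩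
      rcases Sym2.mem_iff.1 hx with rfl | rfl
      exacts [hy, (hT y hy).1]
    · exact fun hx => ⟨_, ⟨x, hx, rfl⟩, Sym2.mem_mk_left _ _⟩
  rw [← ncard_biUnion_const (Set.toFinite _) (fun P : Sym2 α => {x | x ∈ P}), hU]
  · rintro _ ⟨x, hx, rfl⟩ _ ⟨y, hy, rfl⟩ hne
    refine Set.disjoint_left.2 fun z hz hz' => hne ?_
    have key (w : α) (hw : w ∈ T) (hzw : z ∈ s(w, f w)) : s(w, f w) = s(z, f z) := by
      rcases Sym2.mem_iff.1 hzw with rfl | rfl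
      · rfl
      · rw [(hT w hw).2.2, Sym2.eq_swap]
    rw [key x hx hz, key y hy hz']
  · rintro _ ⟨x, hx, rfl⟩
    have : {z | z ∈ s(x, f x)} = {x, f x} := by
      ext z
      simp
    rw [this, Set.ncard_pair (hT x hx).2.1.symm]

/-! ### Cosets closed under inversion. -/

section Cosets

variable {G : Type*} [Group G]

/-- Here `(gB)⁻¹ = Bg⁻¹`. Equality puts `g` in `Bg⁻¹`, so `g * g ∈ B`. Given that, `g⁻¹x ∈ B` iff
`gx ∈ B`, and equality becomes the normalizer condition `xg ∈ B ↔ gx ∈ B`. -/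
theorem inv_smul_coe_eq_iff (B : Subgroup G) (g : G) :
    (g • (B : Set G))⁻¹ = g • (B : Set G) ↔
      g ∈ Subgroup.normalizer (B : Set G) ∧ g * g ∈ B := by
  have hinv (x : G) : x ∈ (g • (B : Set G))⁻¹ ↔ x * g ∈ B := by
    rw [Set.mem_inv, Set.mem_smul_set_iff_inv_smul_mem, smul_eq_mul, ← mul_inv_rev,
      SetLike.mem_coe, inv_mem_iff]
  have hsmul (x : G) : x ∈ g • (B : Set G) ↔ g⁻¹ * x ∈ B := by
    rw [Set.mem_smul_set_iff_inv_smul_mem, smul_eq_mul, SetLike.mem_coe]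
  have hmul (hsq : g * g ∈ B) (x : G) : g⁻¹ * x ∈ B ↔ g * x ∈ B := by
    rw [← B.mul_mem_cancel_left hsq, mul_assoc, mul_inv_cancel_left]
  simp only [Set.ext_iff, hinv, hsmul]
  constructor
  · intro h
    have hsq : g * g ∈ B := (h g).2 (by simp)
    exact ⟨Subgroup.mem_normalizer_iff'.2 fun x => (h x).trans (hmul hsq x), hsq⟩
  · rintro ⟨hN, hsq⟩ x
    exact (Subgroup.mem_normalizer_iff'.1 hN x).trans (hmul hsq x).symm

/-- The subgroup is recovered from its coset as `(gB)⁻¹(gB)`. -/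
theorem smul_coe_injective {B B' : Subgroup G} {g g' : G}
    (h : g • (B : Set G) = g' • (B' : Set G)) : B = B' := by
  have key (B : Subgroup G) (g : G) : (g • (B : Set G))⁻¹ * (g • (B : Set G)) = B := by
    ext x
    simp only [Set.mem_mul, Set.mem_inv, Set.mem_smul_set]
    constructor
    · rintro ⟨y, ⟨b, hb, hy⟩, _, ⟨c, hc, rfl⟩, rfl⟩
      have : y * g • c = b⁻¹ * c := by
        rw [← inv_inv y, ← hy]
        simp [mul_assoc]
      rw [this]
      exact B.mul_mem (B.inv_mem hb) hc
    · intro hx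
      exact ⟨g⁻¹, ⟨1, B.one_mem, by simp⟩, g • x, ⟨x, hx, rfl⟩, by simp⟩
  exact SetLike.coe_injective (by rw [← key B g, h, key])

theorem smul_coe_eq_iff {B : Subgroup G} {g g' : G} :
    g • (B : Set G) = g' • (B : Set G) ↔ g⁻¹ * g' ∈ B :=
  leftCoset_eq_iff B

theorem ncard_cosets (B : Subgroup G) :
    {C : Set G | ∃ g : G, C = g • (B : Set G)}.ncard = B.index := by
  have hinj : Function.Injective fun q : G ⧸ B => q.out • (B : Set G) := by
    intro q q' h
    rw [← q.out_eq', ← q'.out_eq']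
    exact QuotientGroup.eq.2 (smul_coe_eq_iff.1 h)
  rw [Subgroup.index, ← Set.ncard_univ, ← Set.ncard_image_of_injective _ hinj]
  congr 1
  ext C
  simp only [Set.image_univ, Set.mem_range, Set.mem_ofPred_eq]
  constructor
  · rintro ⟨g, rfl⟩
    exact ⟨g, smul_coe_eq_iff.2 (QuotientGroup.eq.1 (Quotient.out_eq' _))⟩
  · rintro ⟨q, rfl⟩
    exact ⟨_, rfl⟩

theorem ncard_selfdual_cosets (B : Subgroup G) :
    {C : Set G | (∃ g : G, C = g • (B : Set G)) ∧ C⁻¹ = C}.ncard =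
      {q : Subgroup.normalizer (B : Set G) ⧸ B.subgroupOf (Subgroup.normalizer (B : Set G)) |
        q * q = 1}.ncard := by
  have hmul (n : Subgroup.normalizer (B : Set G)) :
      ((n : Subgroup.normalizer (B : Set G) ⧸ B.subgroupOf (Subgroup.normalizer (B : Set G))) * n
        = 1) ↔ (n * n : G) ∈ B := by
    rw [← QuotientGroup.mk_mul, QuotientGroup.eq_one_iff, Subgroup.mem_subgroupOf]
    rfl
  have heq (n n' : Subgroup.normalizer (B : Set G)) :
      (n : G) • (B : Set G) = (n' : G) • (B : Set G) ↔
        (n : Subgroup.normalizer (B : Set G) ⧸ B.subgroupOf (Subgroup.normalizer (B : Set G)))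
          = n' := by
    rw [smul_coe_eq_iff, QuotientGroup.eq, Subgroup.mem_subgroupOf]
    rfl
  have hinj : Function.Injective
      fun q : Subgroup.normalizer (B : Set G) ⧸ B.subgroupOf (Subgroup.normalizer (B : Set G)) =>
        (q.out : G) • (B : Set G) := by
    intro q q' h
    rw [← q.out_eq', ← q'.out_eq']
    exact (heq _ _).1 h
  rw [← Set.ncard_image_of_injective _ hinj]
  congr 1
  ext C
  simp only [Set.mem_image, Set.mem_ofPred_eq]
  constructor
  · rintro ⟨⟨g, rfl⟩, h⟩
    obtain ⟨hN, hsq⟩ := (inv_smul_coe_eq_iff B g).1 h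
    exact ⟨QuotientGroup.mk ⟨g, hN⟩, (hmul ⟨g, hN⟩).2 hsq, (heq _ ⟨g, hN⟩).2 (Quotient.out_eq' _)⟩
  · rintro ⟨q, hq, rfl⟩
    refine ⟨⟨_, rfl⟩, (inv_smul_coe_eq_iff B _).2 ⟨q.out.2, (hmul _).1 ?_⟩⟩
    rwa [show (q.out : _ ⧸ _) = q from Quotient.out_eq' q]

end Cosets

/-! ### Duality and the final counts. -/

theorem orderOf_le_two_iff {H : Type*} [Group H] [Finite H] (q : H) :
    orderOf q ≤ 2 ↔ q * q = 1 := by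
  rw [← pow_two, ← orderOf_dvd_iff_pow_eq_one]
  have := orderOf_pos q
  constructor
  · intro h
    interval_cases orderOf q <;> simp
  · exact Nat.le_of_dvd two_pos

theorem dual_eq_inv {d : ℕ} (C : Set (Equiv.Perm (Fin d))) : dual C = C⁻¹ :=
  Set.image_inv_eq_inv

theorem isSelfDual_iff {d : ℕ} (C : Set (Equiv.Perm (Fin d))) : IsSelfDual C ↔ C⁻¹ = C := by
  rw [IsSelfDual, dual_eq_inv]

theorem isSelfDual_smul_iff (B : Subgroup (Equiv.Perm (Fin 8))) (π : Equiv.Perm (Fin 8)) :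
    IsSelfDual (π • (B : Set (Equiv.Perm (Fin 8)))) ↔
      ∃ h : π ∈ Subgroup.normalizer (B : Set (Equiv.Perm (Fin 8))),
        orderOf (QuotientGroup.mk ⟨π, h⟩ : NormQuot B) ≤ 2 := by
  rw [isSelfDual_iff, inv_smul_coe_eq_iff, ← exists_prop]
  refine exists_congr fun h => ?_
  rw [orderOf_le_two_iff, ← QuotientGroup.mk_mul, QuotientGroup.eq_one_iff,
    Subgroup.mem_subgroupOf]
  rfl

theorem ncard_selfdual_cosets_of_mem {B : Subgroup (Equiv.Perm (Fin 8))}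
    (hB : B ∈ conjugatesOfA) :
    {C : Set (Equiv.Perm (Fin 8)) | (∃ π : Equiv.Perm (Fin 8),
      C = π • (B : Set (Equiv.Perm (Fin 8)))) ∧ IsSelfDual C}.ncard = 22 := by
  simp only [isSelfDual_iff]
  rw [ncard_selfdual_cosets]
  have h : {q : NormQuot B | q * q = 1} = insert 1 {q : NormQuot B | orderOf q = 2} := by
    ext q
    rw [Set.mem_insert_iff, Set.mem_ofPred_eq, Set.mem_ofPred_eq, orderOf_eq_prime_iff, pow_two]
    constructor
    · tauto
    · rintro (rfl | h)
      exacts [mul_one 1, h.1]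
  change {q : NormQuot B | q * q = 1}.ncard = 22
  rw [h, Set.ncard_insert_of_notMem (by simp), ncard_orderOf_two hB]

theorem pairwiseDisjoint_cosets (S : Set (Subgroup (Equiv.Perm (Fin 8))))
    (p : Set (Equiv.Perm (Fin 8)) → Prop) :
    S.PairwiseDisjoint fun B => {C : Set (Equiv.Perm (Fin 8)) | (∃ π : Equiv.Perm (Fin 8),
      C = π • (B : Set (Equiv.Perm (Fin 8)))) ∧ p C} := by
  rintro B - B' - hne
  refine Set.disjoint_left.2 ?_
  rintro _ ⟨⟨π, rfl⟩, -⟩ ⟨⟨π', h⟩, -⟩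
  exact hne (smul_coe_injective h)

theorem setOf_mem_grPermSets (p : Set (Equiv.Perm (Fin 8)) → Prop) :
    {C ∈ grPermSets 8 8 | p C} = ⋃ B ∈ conjugatesOfA,
      {C : Set (Equiv.Perm (Fin 8)) | (∃ π : Equiv.Perm (Fin 8),
        C = π • (B : Set (Equiv.Perm (Fin 8)))) ∧ p C} := by
  ext C
  simp only [Set.mem_ofPred_eq, mem_grPermSets_iff, Set.mem_iUnion, exists_prop]
  tauto

theorem ncard_selfdual : {C ∈ grPermSets 8 8 | IsSelfDual C}.ncard = 660 := by
  rw [setOf_mem_grPermSets, ncard_biUnion_const (Set.toFinite _) _ (pairwiseDisjoint_cosets _ _)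
    fun B hB => ncard_selfdual_cosets_of_mem hB, ncard_conjugatesOfA]

theorem index_of_mem_conjugatesOfA {B : Subgroup (Equiv.Perm (Fin 8))} (hB : B ∈ conjugatesOfA) :
    B.index = 5040 := by
  refine Nat.eq_of_mul_eq_mul_right (show 0 < 8 by norm_num) ?_
  calc B.index * 8 = Nat.card (Equiv.Perm (Fin 8)) :=
        (congrArg (B.index * ·) (card_of_mem_conjugatesOfA hB).symm).trans B.index_mul_card
    _ = 5040 * 8 := by
        rw [Nat.card_perm, Nat.card_fin]
        norm_num [Nat.factorial]

theorem ncard_grPermSets : (grPermSets 8 8).ncard = 151200 := by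
  have h := ncard_biUnion_const (Set.toFinite _) _
    (pairwiseDisjoint_cosets conjugatesOfA fun _ => True) (k := 5040) fun B hB => by
      simp only [and_true, ncard_cosets, index_of_mem_conjugatesOfA hB]
  rw [← setOf_mem_grPermSets, ncard_conjugatesOfA] at h
  simpa using h

theorem ncard_not_selfdual : {C ∈ grPermSets 8 8 | ¬ IsSelfDual C}.ncard = 150540 := by
  have h := Set.ncard_sdiff_add_ncard_of_subset
    (Set.sep_subset (grPermSets 8 8) fun C => IsSelfDual C)
  rw [ncard_selfdual, ncard_grPermSets] at h
  have h' : grPermSets 8 8 \ {C ∈ grPermSets 8 8 | IsSelfDual C} =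
      {C ∈ grPermSets 8 8 | ¬ IsSelfDual C} := by
    ext C
    exact and_congr_right fun hC => not_congr (and_iff_right hC)
  rw [h'] at h
  exact Nat.add_right_cancel (h.trans (by norm_num : 151200 = 150540 + 660))

theorem dual_dual {d : ℕ} (C : Set (Equiv.Perm (Fin d))) : dual (dual C) = C := by
  rw [dual_eq_inv, dual_eq_inv, inv_inv]

/-- The inverse of `πB` is `Bπ⁻¹ = π⁻¹(πBπ⁻¹)`, a left coset of another conjugate of `A`. -/
theorem dual_mem_grPermSets {C : Set (Equiv.Perm (Fin 8))} (hC : C ∈ grPermSets 8 8) :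
    dual C ∈ grPermSets 8 8 := by
  obtain ⟨B, ⟨τ, rfl⟩, π, rfl⟩ := (mem_grPermSets_iff C).1 hC
  refine (mem_grPermSets_iff _).2
    ⟨A.map (MulAut.conj (π * τ)).toMonoidHom, ⟨_, rfl⟩, π⁻¹, ?_⟩
  rw [dual_eq_inv]
  ext x
  simp only [Set.mem_inv, Set.mem_smul_set_iff_inv_smul_mem, smul_eq_mul, SetLike.mem_coe]
  rw [← inv_mem_iff]
  simp only [mul_inv_rev, inv_inv, Subgroup.mem_map, MulEquiv.toMonoidHom_eq_coe,
    MonoidHom.coe_coe, MulAut.conj_apply]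
  refine exists_congr fun b => and_congr_right fun _ => ?_
  have h : π * τ * b * (τ⁻¹ * π⁻¹) = π * (τ * b * τ⁻¹) * π⁻¹ := by group
  rw [h, mul_inv_eq_iff_eq_mul (b := π), mul_assoc π x π, mul_right_inj]

end Garden

theorem mainTheorem8 :
    -- The `GR(8,8)` permutation sets are exactly the left cosets `πB` of the conjugates `B` of `A`.
    (∀ C : Set (Equiv.Perm (Fin 8)), C ∈ Garden.grPermSets 8 8 ↔
      ∃ B ∈ Garden.conjugatesOfA, ∃ π : Equiv.Perm (Fin 8),
        C = π • (B : Set (Equiv.Perm (Fin 8)))) ∧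
    -- The group `A` has 30 conjugates.
    Garden.conjugatesOfA.ncard = 30 ∧
    (∀ B ∈ Garden.conjugatesOfA,
      -- `πB` is self-dual iff `π ∈ N(B)` and `πB` has order at most 2 in `N(B)/B`.
      (∀ π : Equiv.Perm (Fin 8),
        Garden.IsSelfDual (π • (B : Set (Equiv.Perm (Fin 8)))) ↔
          ∃ h : π ∈ Subgroup.normalizer (B : Set (Equiv.Perm (Fin 8))),
            orderOf (QuotientGroup.mk ⟨π, h⟩ : Garden.NormQuot B) ≤ 2) ∧
      -- `N(B)/B ≅ SL_3(ℤ_2)`.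
      Nonempty (Garden.NormQuot B ≃* Matrix.SpecialLinearGroup (Fin 3) (ZMod 2)) ∧
      -- In `N(B)/B` the identity is the only element of order 1, and 21 elements have order 2.
      {q : Garden.NormQuot B | orderOf q = 1} = {1} ∧
      {q : Garden.NormQuot B | orderOf q = 2}.ncard = 21 ∧
      -- Exactly 22 left cosets of `B` are self-dual.
      {C : Set (Equiv.Perm (Fin 8)) | (∃ π : Equiv.Perm (Fin 8),
        C = π • (B : Set (Equiv.Perm (Fin 8)))) ∧ Garden.IsSelfDual C}.ncard = 22) ∧
    -- There are 660 self-dual permutation sets.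
    {C ∈ Garden.grPermSets 8 8 | Garden.IsSelfDual C}.ncard = 660 ∧
    -- The dual of a permutation set is a permutation set, and the sets that are not self-dual
    -- form 75270 unordered pairs of mutually dual sets.
    (∀ C ∈ Garden.grPermSets 8 8, Garden.dual C ∈ Garden.grPermSets 8 8 ∧
      Garden.dual (Garden.dual C) = C) ∧
    {P : Sym2 (Set (Equiv.Perm (Fin 8))) | ∃ C ∈ Garden.grPermSets 8 8,
      ¬ Garden.IsSelfDual C ∧ P = s(C, Garden.dual C)}.ncard = 75270 := by
  refine ⟨Garden.mem_grPermSets_iff, Garden.ncard_conjugatesOfA,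
    fun B hB => ⟨Garden.isSelfDual_smul_iff B, Garden.nonempty_normQuot_equiv hB, ?_,
      Garden.ncard_orderOf_two hB, Garden.ncard_selfdual_cosets_of_mem hB⟩,
    Garden.ncard_selfdual, fun C hC => ⟨Garden.dual_mem_grPermSets hC, Garden.dual_dual C⟩, ?_⟩
  · ext q
    simp
  · have h := Garden.two_mul_ncard_pairs (f := Garden.dual)
      (T := {C ∈ Garden.grPermSets 8 8 | ¬ Garden.IsSelfDual C}) fun C hC =>
        ⟨⟨Garden.dual_mem_grPermSets hC.1, fun h => hC.2 ?_⟩, hC.2, Garden.dual_dual C⟩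
    · rw [Garden.ncard_not_selfdual] at h
      simp only [Set.mem_ofPred_eq, and_assoc] at h
      exact Nat.eq_of_mul_eq_mul_right two_pos (h.trans (by norm_num : 150540 = 75270 * 2))
    · rw [Garden.IsSelfDual, Garden.dual_dual] at h
      exact h.symm
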